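/- Let $\mathcal G$ be a finite undirected graph without self-loops on vertices $1,\dots,n$, with a symmetric adjacency matrix $A$ whose entry $A_{ij}$ is positive if $i$ and $j$ are joined by an edge and $0$ otherwise (the graph may be weighted; in the unweighted case the entries are $0$ or $1$). Let $D$ be the diagonal matrix of the degrees $\sum_j A_{ij}$, and let $L = I - D^{-1/2} A D^{-1/2}$ be the normalized Laplacian, where all entries in the row and in the column of an isolated vertex are set to $0$. Let $d_{\mathcal G}(i,j)$ denote the hop distance (the least number of edges of a path from $i$ to $j$, and $\infty$ if there is none). Let $p$ be a real polynomial of degree $K>0$ with $0<p(\lambda)<1$ for all $\lambda\in[0,2]$. For $Q=\operatorname{diag}(q_1,\dots,q_n)$ with all $q_i>0$, put $R=(p(L)+Q)^{-1}Q$. For every such $Q$ the matrix $p(L)+Q$ is invertible, so $R$ is well defined, and the following hold. (i) For every such $Q$, $R_{ij}=0$ whenever $i$ and $j$ lie in different connected components of $\mathcal G$. (ii) If $p(\lambda)=a+b\lambda$ with $b>0$, then for every such $Q$, $R_{ij}>0$ for all $i,j$ in the same connected component. (iii) If $P=p(L)$ has complete $K$-hop support, that is, $P_{ij}\neq 0 \iff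 d_{\mathcal G}(i,j)\le K$ for all $i,j$, then for Lebesgue-almost every $(q_1,\dots,q_n)\in(0,\infty)^n$, one has $R_{ij}\neq 0$ simultaneously for all $i,j$ in the same connected component. -/

import Mathlib

open Polynomial MeasureTheory

/-- A finite undirected graph without self-loops, with positive edge weights: two vertices are joined
by an edge exactly when the corresponding entry of the (weighted) adjacency matrix is nonzero.
An unweighted graph is the case where all entries are `0` or `1`. -/
structure WeightedGraph (V : Type*) where
  /-- The (weighted) adjacency matrix. -/
  adj : Matrix V V ℝ
  symm : ∀ i j, adj i j = adj j i
  nonneg : ∀ i j, 0 ≤ adj i j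
  loopless : ∀ i, adj i i = 0

namespace WeightedGraph

/-- The underlying simple graph, which carries connected components and the hop distance. -/
def graph {V : Type*} (G : WeightedGraph V) : SimpleGraph V where
  Adj i j := G.adj i j ≠ 0
  symm := ⟨fun i j h => by rw [G.symm j i]; exact h⟩
  loopless := ⟨fun i h => h (G.loopless i)⟩

/-- The (weighted) degree of a vertex. It vanishes exactly at the isolated vertices. -/
def degree {V : Type*} [Fintype V] (G : WeightedGraph V) (i : V) : ℝ :=
  ∑ j, G.adj i j

/-- The normalized Laplacian `I - D^(-1/2) A D^(-1/2)`, where the row and the column of every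
isolated vertex are set to zero. -/
noncomputable def normLap {V : Type*} [Fintype V] [DecidableEq V] (G : WeightedGraph V) :
    Matrix V V ℝ :=
  Matrix.of fun i j =>
    if G.degree i = 0 ∨ G.degree j = 0 then 0
    else (1 : Matrix V V ℝ) i j - (√(G.degree i))⁻¹ * G.adj i j * (√(G.degree j))⁻¹

/-- The matrix `p(L)`. -/
noncomputable def filter {V : Type*} [Fintype V] [DecidableEq V] (G : WeightedGraph V)
    (p : ℝ[X]) : Matrix V V ℝ :=
  aeval G.normLap p

/-- The Tikhonov operator `R = (p(L) + Q)⁻¹ Q`, with `Q = diag(q)`. -/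
noncomputable def tikhonov {V : Type*} [Fintype V] [DecidableEq V] (G : WeightedGraph V)
    (p : ℝ[X]) (q : V → ℝ) : Matrix V V ℝ :=
  (G.filter p + Matrix.diagonal q)⁻¹ * Matrix.diagonal q

/-- Complete `K`-hop support of a matrix `P`: the entry `P i j` is nonzero exactly when the hop
distance of `i` and `j` (infinite between different components) is at most `K`. -/
def CompleteHopSupport {V : Type*} (G : WeightedGraph V) (P : Matrix V V ℝ) (K : ℕ) : Prop :=
  ∀ i j, P i j ≠ 0 ↔ G.graph.edist i j ≤ (K : ℕ∞)

end WeightedGraph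

/-! The spectrum of `L` lies in `[0, 2]`, where `p > 0`, so `M = p(L) + Q` is positive definite.
Since `R i j = M⁻¹ i j * q j` with `q j > 0`, only the zeros and signs of `M⁻¹` matter. (i) `M`
commutes with the diagonal indicator of a component, hence so does `M⁻¹`. (ii) For `p = a + bλ` with
`b > 0`, `M` is a Stieltjes matrix: its off-diagonal entries are nonpositive, so `M⁻¹ ≥ 0`, and a
zero in a column of `M⁻¹` would spread along edges to the diagonal (`inv_pos_of_offDiag_nonpos`).
(iii) By Cramer's rule the numerator of `M⁻¹ i j` is a polynomial in `q`, so its zero set is null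
unless it vanishes identically. That it does not is seen on `1 + E P`, where `E = Q⁻¹` may
degenerate: entries of `E` are switched on one by one along a shortest path
(`exists_diagonal_solution_ne_zero`). -/

/-! ### Zero sets of real polynomials -/

/-- The zero set of a nonzero real polynomial in finitely many ordered variables is a null set. -/
theorem MvPolynomial.ae_eval_ne_zero_fin {n : ℕ} {f : MvPolynomial (Fin n) ℝ} (hf : f ≠ 0) :
    ∀ᵐ x : Fin n → ℝ, MvPolynomial.eval x f ≠ 0 := by
  induction n with
  | zero =>
    refine Filter.Eventually.of_forall fun x hx => hf ?_
    refine MvPolynomial.funext fun y => ?_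
    rw [Subsingleton.elim y x, hx, map_zero]
  | succ n ih =>
    have hne : MvPolynomial.finSuccEquiv ℝ n f ≠ 0 := by simpa using hf
    obtain ⟨k, hk⟩ : ∃ k, (MvPolynomial.finSuccEquiv ℝ n f).coeff k ≠ 0 := by
      by_contra! h
      exact hne (Polynomial.ext fun k => by simpa using h k)
    have hcons : Measurable fun z : (Fin n → ℝ) × ℝ =>
        MvPolynomial.eval (Fin.cons z.2 z.1 : Fin (n + 1) → ℝ) f := by
      refine Continuous.measurable ?_
      exact (MvPolynomial.continuous_eval f).comp (by fun_prop)
    -- Fubini: for almost every value of the last `n` variables the `k`-th coefficient in the first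
    -- variable is nonzero, and the slice is then a finite set of roots.
    have hprod : ∀ᵐ z : (Fin n → ℝ) × ℝ,
        MvPolynomial.eval (Fin.cons z.2 z.1 : Fin (n + 1) → ℝ) f ≠ 0 := by
      have hs : MeasurableSet {z : (Fin n → ℝ) × ℝ |
          MvPolynomial.eval (Fin.cons z.2 z.1 : Fin (n + 1) → ℝ) f ≠ 0}ᶜ := by
        refine MeasurableSet.compl ?_
        exact hcons (measurableSet_singleton 0).compl
      rw [ae_iff]
      refine (Measure.measure_prod_null hs).2 ?_
      filter_upwards [ih hk] with s hs
      have hp : Polynomial.map (MvPolynomial.eval s) (MvPolynomial.finSuccEquiv ℝ n f) ≠ 0 := by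
        intro h
        apply hs
        rw [← Polynomial.coeff_map, h, Polynomial.coeff_zero]
      refine Set.Finite.measure_zero
        ((Polynomial.map (MvPolynomial.eval s) (MvPolynomial.finSuccEquiv ℝ n f)).roots.toFinset
          |>.finite_toSet.subset ?_) _
      intro y hy
      have hy' : MvPolynomial.eval (Fin.cons y s : Fin (n + 1) → ℝ) f = 0 := by simpa using hy
      rw [MvPolynomial.eval_eq_eval_mv_eval'] at hy'
      simpa [hp] using hy'
    have hswap : ∀ᵐ z : ℝ × (Fin n → ℝ),
        MvPolynomial.eval (Fin.cons z.1 z.2 : Fin (n + 1) → ℝ) f ≠ 0 :=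
      (Measure.measurePreserving_swap (μ := (volume : Measure ℝ))
        (ν := (volume : Measure (Fin n → ℝ)))).quasiMeasurePreserving.ae hprod
    have h := (volume_preserving_piFinSuccAbove (fun _ : Fin (n + 1) => ℝ)
      0).quasiMeasurePreserving.ae hswap
    filter_upwards [h] with x hx
    convert hx using 3
    exact (Fin.cons_self_tail x).symm

/-- The zero set of a nonzero real polynomial in finitely many variables is a null set. -/
theorem MvPolynomial.ae_eval_ne_zero {V : Type*} [Fintype V] {f : MvPolynomial V ℝ} (hf : f ≠ 0) :
    ∀ᵐ x : V → ℝ, MvPolynomial.eval x f ≠ 0 := by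
  let e := Fintype.equivFin V
  have hne : MvPolynomial.rename e f ≠ 0 := by
    simpa using (MvPolynomial.rename_injective e e.injective).ne hf
  have h := (volume_measurePreserving_piCongrLeft (fun _ : Fin (Fintype.card V) => ℝ)
    e).quasiMeasurePreserving.ae (MvPolynomial.ae_eval_ne_zero_fin hne)
  filter_upwards [h] with x hx
  rw [MvPolynomial.eval_rename] at hx
  convert hx using 3
  funext v
  simp [MeasurableEquiv.coe_piCongrLeft]

/-! ### Zero patterns of inverses and adjugates -/

namespace Matrix

variable {V : Type*} [Fintype V] [DecidableEq V]

/-- The inverse of a matrix that commutes with `diagonal d` has no entries between indices at which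
`d` differs. -/
theorem inv_apply_eq_zero_of_commute {M : Matrix V V ℝ} {d : V → ℝ}
    (hM : Commute (diagonal d) M) {i j : V} (hij : d i ≠ d j) : M⁻¹ i j = 0 := by
  have h : diagonal d * M⁻¹ = M⁻¹ * diagonal d := by
    by_cases hu : IsUnit M.det
    · calc diagonal d * M⁻¹ = M⁻¹ * (M * diagonal d) * M⁻¹ := by
            rw [← mul_assoc, nonsing_inv_mul _ hu, one_mul]
        _ = M⁻¹ * diagonal d := by
            rw [← hM.eq, mul_assoc, mul_assoc, mul_nonsing_inv _ hu, mul_one]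
    · rw [nonsing_inv_apply_not_isUnit _ hu, mul_zero, zero_mul]
  have h' := congrFun (congrFun h i) j
  rw [diagonal_mul, mul_diagonal] at h'
  have : (d i - d j) * M⁻¹ i j = 0 := by linarith
  exact (mul_eq_zero.1 this).resolve_left (sub_ne_zero.2 hij)

/-- The inverse of a positive definite matrix with nonpositive off-diagonal entries is entrywise
nonnegative. -/
theorem PosDef.inv_nonneg_of_offDiag_nonpos {M : Matrix V V ℝ} (hM : M.PosDef)
    (hoff : ∀ i j, i ≠ j → M i j ≤ 0) (i j : V) : 0 ≤ M⁻¹ i j := by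
  set x : V → ℝ := fun k => M⁻¹ k j with hx
  have hMx : M *ᵥ x = Pi.single j 1 := by
    have h : M * M⁻¹ = 1 := mul_nonsing_inv _ (isUnit_iff_ne_zero.2 hM.det_pos.ne')
    ext k
    have := congrFun (congrFun h k) j
    rw [mul_apply] at this
    rw [mulVec, dotProduct, this, one_apply, Pi.single_apply]
  -- With `y`, `z` the negative and positive parts of the column `x`, disjointness of supports gives
  -- `y·Mz ≤ 0`, so `y·My = y·Mz - y j ≤ 0` and `y = 0`.
  let y : V → ℝ := fun k => max (-x k) 0
  let z : V → ℝ := fun k => max (x k) 0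
  have hxyz : y = z - x := by
    ext k
    simp only [y, z, Pi.sub_apply]
    rcases le_total (x k) 0 with h | h
    · rw [max_eq_left (by linarith), max_eq_right h]; ring
    · rw [max_eq_right (by linarith), max_eq_left h]; ring
  have hy0 : ∀ k, 0 ≤ y k := fun k => le_max_right _ _
  have hz0 : ∀ k, 0 ≤ z k := fun k => le_max_right _ _
  have hyz : ∀ k, y k * z k = 0 := fun k => by
    simp only [y, z]
    rcases le_total (x k) 0 with h | h
    · rw [max_eq_right h, mul_zero]
    · rw [max_eq_right (by linarith : -x k ≤ 0), zero_mul]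
  have h1 : y ⬝ᵥ (M *ᵥ x) = y j := by rw [hMx]; simp
  have h2 : y ⬝ᵥ (M *ᵥ z) ≤ 0 := by
    simp only [dotProduct, mulVec, Finset.mul_sum]
    refine Finset.sum_nonpos fun k _ => Finset.sum_nonpos fun l _ => ?_
    by_cases hkl : k = l
    · subst hkl
      have : y k * (M k k * z k) = M k k * (y k * z k) := by ring
      rw [this, hyz, mul_zero]
    · exact mul_nonpos_of_nonneg_of_nonpos (hy0 k)
        (mul_nonpos_of_nonpos_of_nonneg (hoff k l hkl) (hz0 l))
  have h3 : y ⬝ᵥ (M *ᵥ y) ≤ 0 := by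
    conv_lhs => rw [hxyz]
    rw [mulVec_sub, dotProduct_sub, ← hxyz, h1]
    linarith [hy0 j]
  have hy : y = 0 := by
    by_contra hne
    have := hM.dotProduct_mulVec_pos hne
    simp only [star_trivial] at this
    linarith
  have := congrFun hy i
  simp only [y, Pi.zero_apply] at this
  have h4 := le_max_left (-x i) 0
  rw [this] at h4
  change 0 ≤ x i
  linarith

/-- The inverse of a positive definite matrix with nonpositive off-diagonal entries is positive
between any two vertices that are connected through nonzero entries. -/
theorem PosDef.inv_pos_of_offDiag_nonpos {M : Matrix V V ℝ} (hM : M.PosDef)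
    (hoff : ∀ i j, i ≠ j → M i j ≤ 0) {H : SimpleGraph V} (hH : ∀ i j, H.Adj i j → M i j ≠ 0)
    {i j : V} (hij : H.Reachable i j) : 0 < M⁻¹ i j := by
  have hnn := hM.inv_nonneg_of_offDiag_nonpos hoff
  have hrow : ∀ k, ∑ l, M k l * M⁻¹ l j = (1 : Matrix V V ℝ) k j := fun k => by
    rw [← mul_apply, mul_nonsing_inv _ (isUnit_iff_ne_zero.2 hM.det_pos.ne')]
  -- If `M⁻¹ k j = 0`, row `k` of `M * M⁻¹ = 1` is a sum of nonpositive terms equal to 0 or 1: it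
  -- must be 0, and every term vanishes.
  have hstep : ∀ k, M⁻¹ k j = 0 → k ≠ j ∧ ∀ l, H.Adj k l → M⁻¹ l j = 0 := by
    intro k hk
    have hterm : ∀ l ∈ Finset.univ, M k l * M⁻¹ l j ≤ 0 := fun l _ => by
      by_cases hkl : k = l
      · subst hkl; rw [hk, mul_zero]
      · exact mul_nonpos_of_nonpos_of_nonneg (hoff k l hkl) (hnn l j)
    have hkj : k ≠ j := by
      rintro rfl
      have := Finset.sum_nonpos hterm
      rw [hrow, one_apply_eq] at this
      linarith
    refine ⟨hkj, fun l hl => ?_⟩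
    have h0 : ∑ l, M k l * M⁻¹ l j = 0 := by rw [hrow, one_apply_ne hkj]
    have := (Finset.sum_eq_zero_iff_of_nonpos hterm).1 h0 l (Finset.mem_univ l)
    exact (mul_eq_zero.1 this).resolve_left (hH k l hl)
  refine lt_of_le_of_ne (hnn i j) fun h0 => ?_
  obtain ⟨w⟩ := hij
  induction w with
  | nil => exact (hstep _ h0.symm).1 rfl
  | cons hadj _ ih => exact ih hrow hstep ((hstep _ h0.symm).2 _ hadj).symm

/-- If `i` and `j` are connected through nonzero entries of `P`, then for a suitable diagonal matrix
`E`, supported near a shortest path, the column of `(1 + E P)⁻¹` at `j` does not vanish at `i`. -/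
theorem exists_diagonal_solution_ne_zero {P : Matrix V V ℝ} {H : SimpleGraph V}
    (hH : ∀ u v, H.Adj u v ↔ u ≠ v ∧ P u v ≠ 0) (j : V) (m : ℕ) (v : V) (hr : H.Reachable v j)
    (hd : H.dist v j = m) :
    ∃ e x : V → ℝ, (1 + diagonal e * P).det ≠ 0 ∧
      (1 + diagonal e * P) *ᵥ x = Pi.single j 1 ∧
      (∀ u, e u ≠ 0 → u = v ∨ H.dist u j < m) ∧ x v ≠ 0 := by
  induction m generalizing v with
  | zero =>
    obtain rfl := hr.dist_eq_zero_iff.1 hd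
    refine ⟨0, Pi.single v 1, by simp, ?_, by simp, by simp⟩
    rw [Pi.zero_def, diagonal_zero, zero_mul, add_zero, one_mulVec]
  | succ m ih =>
    obtain ⟨w, hw⟩ := hr.exists_walk_length_eq_dist
    cases w with
    | nil => simp at hd
    | @cons _ v' _ hadj w' =>
    have hr' : H.Reachable v' j := w'.reachable
    have hd' : H.dist v' j = m := by
      have h1 : H.dist v' j ≤ m := by
        have := SimpleGraph.dist_le w'
        simp only [SimpleGraph.Walk.length_cons] at hw
        omega
      have h2 := hr'.dist_triangle_right v
      rw [SimpleGraph.dist_eq_one_iff_adj.2 hadj] at h2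
      omega
    obtain ⟨e, x, hdet, hx, hsupp, hxv⟩ := ih v' hr' hd'
    have hev : e v = 0 := by
      by_contra h
      rcases hsupp v h with h | h
      · exact hadj.ne h
      · omega
    have hvj : v ≠ j := by
      rintro rfl
      simp at hd
    have hrow : ∀ (e x : V → ℝ) (u : V),
        ((1 + diagonal e * P) *ᵥ x) u = x u + e u * (P *ᵥ x) u := fun e x u => by
      rw [add_mulVec, one_mulVec, ← mulVec_mulVec, Pi.add_apply, mulVec_diagonal]
    -- Where `e u = 0`, row `u` of the system forces `x u` to be 0 unless `u = j`. Neighbours of `v`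
    -- are at distance at least `m` from `j`, so only `v'` contributes.
    have hPx : (P *ᵥ x) v = P v v' * x v' := by
      rw [mulVec, dotProduct]
      refine Finset.sum_eq_single v' (fun u _ hu => ?_) (by simp)
      by_contra hne
      obtain ⟨hP, hxu⟩ := mul_ne_zero_iff.1 hne
      by_cases hvu : v = u
      · subst hvu
        have := congrFun hx v
        rw [hrow, hev, Pi.single_eq_of_ne hvj] at this
        exact hxu (by linarith)
      · have huadj : H.Adj v u := (hH v u).2 ⟨hvu, hP⟩
        -- Needed because `H.dist` takes the value 0 on unreachable pairs.
        have hur : H.Reachable u j := huadj.symm.reachable.trans hr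
        have h2 := hur.dist_triangle_right v
        rw [SimpleGraph.dist_eq_one_iff_adj.2 huadj] at h2
        have heu : e u = 0 := by
          by_contra h
          rcases hsupp u h with h | h
          · exact hu h
          · omega
        have := congrFun hx u
        rw [hrow, heu] at this
        by_cases huj : u = j
        · subst huj
          simp only [SimpleGraph.dist_self] at h2
          have : m = 0 := by omega
          subst this
          exact hu (hr'.dist_eq_zero_iff.1 hd').symm
        · rw [Pi.single_eq_of_ne huj] at this
          exact hxu (by linarith)
    have hPx0 : (P *ᵥ x) v ≠ 0 := by
      rw [hPx]
      exact mul_ne_zero ((hH v v').1 hadj).2 hxv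
    have hcont : Continuous fun t : ℝ => (1 + diagonal (Function.update e v t) * P).det := by
      refine Continuous.matrix_det ?_
      refine continuous_const.add (Continuous.matrix_mul ?_ continuous_const)
      exact Continuous.matrix_diagonal (continuous_const.update v continuous_id)
    have hev0 : ∀ᶠ t in nhds (0 : ℝ), (1 + diagonal (Function.update e v t) * P).det ≠ 0 := by
      refine hcont.continuousAt.eventually_ne ?_
      have : Function.update e v 0 = e := by rw [← hev, Function.update_eq_self]
      rwa [this]
    -- A small nonzero `t` at `v` keeps the determinant nonzero.
    obtain ⟨t, ht, ht0⟩ := ((hev0.filter_mono nhdsWithin_le_nhds).and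
      (self_mem_nhdsWithin (a := (0 : ℝ)) (s := {0}ᶜ))).exists
    set e' := Function.update e v t with he'
    set x' := (1 + diagonal e' * P)⁻¹ *ᵥ Pi.single j (1 : ℝ) with hx'
    have hx'eq : (1 + diagonal e' * P) *ᵥ x' = Pi.single j 1 := by
      rw [hx', mulVec_mulVec, mul_nonsing_inv _ (isUnit_iff_ne_zero.2 ht), one_mulVec]
    refine ⟨e', x', ht, hx'eq, fun u hu => ?_, fun h0 => ?_⟩
    · by_cases huv : u = v
      · exact Or.inl huv
      · rw [he', Function.update_of_ne huv] at hu
        rcases hsupp u hu with rfl | h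
        · right; omega
        · right; omega
    -- If `x' v = 0`, row `v` gives `(P x') v = 0`, so `x'` also solves the old system. Then `x' =
    -- x`, against `(P x) v ≠ 0`.
    · have hPx' : (P *ᵥ x') v = 0 := by
        have := congrFun hx'eq v
        rw [hrow, h0, Pi.single_eq_of_ne hvj, he', Function.update_self, zero_add] at this
        exact (mul_eq_zero.1 this).resolve_left ht0
      have hxx' : (1 + diagonal e * P) *ᵥ x' = Pi.single j 1 := by
        ext u
        by_cases huv : u = v
        · rw [huv, hrow, h0, hPx', Pi.single_eq_of_ne hvj]; ring
        · rw [← hx'eq, hrow, hrow, he', Function.update_of_ne huv]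
      have : x' = x := by
        refine mulVec_injective_of_isUnit
          ((isUnit_iff_isUnit_det _).2 (isUnit_iff_ne_zero.2 hdet)) ?_
        exact hxx'.trans hx.symm
      rw [this] at hPx'
      exact hPx0 hPx'

/-- If `i` and `j` are connected through nonzero entries of `P`, then the `(i, j)` entry of the
adjugate of `P + diag q` does not vanish for almost every `q`. -/
theorem ae_adjugate_add_diagonal_ne_zero {P : Matrix V V ℝ} {H : SimpleGraph V}
    (hH : ∀ u v, H.Adj u v ↔ u ≠ v ∧ P u v ≠ 0) {i j : V} (hr : H.Reachable i j) :
    ∀ᵐ q : V → ℝ, (P + diagonal q).adjugate i j ≠ 0 := by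
  have heval : ∀ (q : V → ℝ), (MvPolynomial.eval q).mapMatrix
      (P.map MvPolynomial.C + diagonal MvPolynomial.X) = P + diagonal q := fun q => by
    ext u v
    by_cases huv : u = v <;> simp [huv]
  have heval' : ∀ (q : V → ℝ), (MvPolynomial.eval q).mapMatrix
      (1 + diagonal MvPolynomial.X * P.map MvPolynomial.C) = 1 + diagonal q * P := fun q => by
    ext u v
    by_cases huv : u = v <;> simp [huv]
  let N : MvPolynomial V ℝ :=
    (1 + diagonal MvPolynomial.X * P.map MvPolynomial.C).adjugate i j
  have hN : ∀ q, MvPolynomial.eval q N = (1 + diagonal q * P).adjugate i j := fun q => by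
    rw [← heval' q, ← RingHom.map_adjugate]; rfl
  have hN0 : N ≠ 0 := by
    obtain ⟨e, x, hdet, hx, -, hxi⟩ := exists_diagonal_solution_ne_zero hH j _ i hr rfl
    intro h
    have h0 := hN e
    rw [h, map_zero] at h0
    have hxadj : (1 + diagonal e * P).det • x = (1 + diagonal e * P).adjugate *ᵥ Pi.single j 1 := by
      rw [← hx, mulVec_mulVec, adjugate_mul, smul_mulVec, one_mulVec]
    have := congrFun hxadj i
    rw [mulVec_single_one, col_apply, ← h0, Pi.smul_apply, smul_eq_mul] at this
    exact mul_ne_zero hdet hxi this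
  -- The factor `∏ u, X u` yields a point with no zero coordinate, at which `E` is invertible and `1
  -- + E P = E (P + E⁻¹)`.
  obtain ⟨e, he⟩ : ∃ e, MvPolynomial.eval e (N * ∏ u, MvPolynomial.X u) ≠ 0 := by
    by_contra! h
    refine mul_ne_zero hN0 (Finset.prod_ne_zero_iff (s := Finset.univ).2
      fun u _ => MvPolynomial.X_ne_zero (R := ℝ) u)
      (MvPolynomial.funext fun e => ?_)
    rw [h, map_zero]
  rw [map_mul, map_prod, mul_ne_zero_iff, Finset.prod_ne_zero_iff, hN] at he
  have he0 : ∀ u, e u ≠ 0 := fun u => by simpa using he.2 u (Finset.mem_univ u)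
  have hfac : 1 + diagonal e * P = diagonal e * (P + diagonal e⁻¹) := by
    rw [mul_add, diagonal_mul_diagonal, add_comm]
    congr 1
    rw [← diagonal_one]
    congr 1
    ext u
    simp [he0 u]
  have hadj : (P + diagonal e⁻¹).adjugate i j ≠ 0 := by
    intro h
    apply he.1
    rw [hfac, adjugate_mul_distrib, adjugate_diagonal, mul_diagonal, h, zero_mul]
  have hF : ∀ q, MvPolynomial.eval q ((P.map MvPolynomial.C + diagonal MvPolynomial.X).adjugate i j)
      = (P + diagonal q).adjugate i j := fun q => by
    rw [← heval q, ← RingHom.map_adjugate]; rfl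
  have hF0 : (P.map MvPolynomial.C + diagonal MvPolynomial.X).adjugate i j
      ≠ (0 : MvPolynomial V ℝ) := by
    intro h
    apply hadj
    rw [← hF, h, map_zero]
  filter_upwards [MvPolynomial.ae_eval_ne_zero hF0] with q hq
  rwa [hF] at hq

end Matrix

/-! ### Signs and spectrum of the normalized Laplacian -/

namespace WeightedGraph

variable {V : Type*} [Fintype V] (G : WeightedGraph V)

theorem degree_nonneg (i : V) : 0 ≤ G.degree i := Finset.sum_nonneg fun j _ => G.nonneg i j

theorem degree_ne_zero_of_adj {i j : V} (h : G.graph.Adj i j) : G.degree i ≠ 0 := fun h0 =>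
  h ((Finset.sum_eq_zero_iff_of_nonneg fun j _ => G.nonneg i j).1 h0 j (Finset.mem_univ j))

variable [DecidableEq V]

theorem normLap_isHermitian : G.normLap.IsHermitian := by
  ext i j
  simp only [Matrix.conjTranspose_apply, normLap, Matrix.of_apply, star_trivial]
  by_cases h : G.degree i = 0 ∨ G.degree j = 0
  · rw [if_pos h, if_pos h.symm]
  · rw [if_neg h, if_neg fun h' => h h'.symm, G.symm j i, Matrix.one_apply, Matrix.one_apply]
    simp only [eq_comm]
    ring

theorem normLap_apply_of_ne {i j : V} (hij : i ≠ j) :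
    G.normLap i j = -((√(G.degree i))⁻¹ * G.adj i j * (√(G.degree j))⁻¹) := by
  rw [normLap, Matrix.of_apply, Matrix.one_apply_ne hij, zero_sub]
  split_ifs with h
  -- At an isolated vertex `(√0)⁻¹ = 0`, so the formula also gives 0.
  · rcases h with h | h <;> simp [h]
  · rfl

theorem normLap_nonpos_of_ne {i j : V} (hij : i ≠ j) : G.normLap i j ≤ 0 := by
  rw [G.normLap_apply_of_ne hij, neg_nonpos]
  have := G.nonneg i j
  positivity

theorem normLap_ne_zero_of_adj {i j : V} (h : G.graph.Adj i j) : G.normLap i j ≠ 0 := by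
  rw [G.normLap_apply_of_ne h.ne, neg_ne_zero]
  have hi := Real.sqrt_ne_zero'.2 ((G.degree_nonneg i).lt_of_ne' (G.degree_ne_zero_of_adj h))
  have hj := Real.sqrt_ne_zero'.2 ((G.degree_nonneg j).lt_of_ne' (G.degree_ne_zero_of_adj h.symm))
  exact mul_ne_zero (mul_ne_zero (inv_ne_zero hi) h) (inv_ne_zero hj)

theorem normLap_mulVec (x : V → ℝ) (i : V) :
    (G.normLap.mulVec x) i = if G.degree i = 0 then 0 else
      x i - (√(G.degree i))⁻¹ * ∑ j, G.adj i j * ((√(G.degree j))⁻¹ * x j) := by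
  rw [Matrix.mulVec, dotProduct]
  split_ifs with hi
  · exact Finset.sum_eq_zero fun j _ => by simp [normLap, hi]
  · have h : ∀ j, G.normLap i j * x j = (1 : Matrix V V ℝ) i j * x j -
        (√(G.degree i))⁻¹ * (G.adj i j * ((√(G.degree j))⁻¹ * x j)) := fun j => by
      by_cases hij : i = j
      · subst hij
        simp [normLap, hi, G.loopless]
      · rw [G.normLap_apply_of_ne hij, Matrix.one_apply_ne hij]
        ring
    rw [Finset.sum_congr rfl fun j _ => h j, Finset.sum_sub_distrib, ← Finset.mul_sum]
    simp [Matrix.one_apply]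

/-- The spectrum of the normalized Laplacian lies in `[0, 2]`. -/
theorem spectrum_normLap_subset : spectrum ℝ G.normLap ⊆ Set.Icc 0 2 := by
  intro t ht
  by_cases ht0 : t = 0
  · simp [ht0]
  rw [← Matrix.spectrum_toLin', ← Module.End.hasEigenvalue_iff_mem_spectrum] at ht
  obtain ⟨x, hx, hx0⟩ := ht.exists_hasEigenvector
  rw [Module.End.mem_eigenspace_iff, Matrix.toLin'_apply] at hx
  have hrow := fun i => congrFun hx i
  simp only [G.normLap_mulVec, Pi.smul_apply, smul_eq_mul] at hrow
  obtain ⟨k, hk⟩ := Function.ne_iff.1 hx0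
  have : Nonempty V := ⟨k⟩
  -- Maximum principle for `y = D^(-1/2) x`: the eigenvalue equation reads `(1 - t) y i * degree i =
  -- ∑ j, A i j * y j`, so maximality of `|y i|` gives `|1 - t| ≤ 1`. As `t ≠ 0`, `x` vanishes at
  -- isolated vertices.
  obtain ⟨i, hi⟩ := Finite.exists_max fun i => |(√(G.degree i))⁻¹ * x i|
  have hpos : ∀ l, x l ≠ 0 → 0 < G.degree l := fun l hl => by
    refine (G.degree_nonneg l).lt_of_ne' fun h0 => ?_
    have := hrow l
    rw [if_pos h0] at this
    exact (mul_ne_zero ht0 hl) this.symm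
  have hk' : 0 < |(√(G.degree k))⁻¹ * x k| :=
    abs_pos.2 (mul_ne_zero (inv_ne_zero (Real.sqrt_ne_zero'.2 (hpos k hk))) hk)
  have hyi := hk'.trans_le (hi k)
  have hdi : 0 < G.degree i := hpos i (right_ne_zero_of_mul (abs_pos.1 hyi))
  have hs : 0 < √(G.degree i) := Real.sqrt_pos.2 hdi
  have heq : (1 - t) * ((√(G.degree i))⁻¹ * x i) * G.degree i =
      ∑ j, G.adj i j * ((√(G.degree j))⁻¹ * x j) := by
    have h := hrow i
    rw [if_neg hdi.ne'] at h
    set S := ∑ j, G.adj i j * ((√(G.degree j))⁻¹ * x j)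
    have h2 : (1 - t) * x i = (√(G.degree i))⁻¹ * S := by linarith
    have h3 : (√(G.degree i))⁻¹ * (√(G.degree i))⁻¹ * G.degree i = 1 := by
      nth_rewrite 3 [← Real.mul_self_sqrt hdi.le]
      field_simp
    calc (1 - t) * ((√(G.degree i))⁻¹ * x i) * G.degree i
        = ((1 - t) * x i) * (√(G.degree i))⁻¹ * G.degree i := by ring
      _ = ((√(G.degree i))⁻¹ * (√(G.degree i))⁻¹ * G.degree i) * S := by rw [h2]; ring
      _ = S := by rw [h3, one_mul]
  have hle : |1 - t| * |(√(G.degree i))⁻¹ * x i| * G.degree i ≤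
      |(√(G.degree i))⁻¹ * x i| * G.degree i := by
    calc |1 - t| * |(√(G.degree i))⁻¹ * x i| * G.degree i
        = |∑ j, G.adj i j * ((√(G.degree j))⁻¹ * x j)| := by
          rw [← heq, abs_mul _ (G.degree i), abs_mul (1 - t), abs_of_pos hdi]
      _ ≤ ∑ j, |G.adj i j * ((√(G.degree j))⁻¹ * x j)| := Finset.abs_sum_le_sum_abs _ _
      _ ≤ ∑ j, G.adj i j * |(√(G.degree i))⁻¹ * x i| := by
          refine Finset.sum_le_sum fun j _ => ?_
          rw [abs_mul, abs_of_nonneg (G.nonneg i j)]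
          exact mul_le_mul_of_nonneg_left (hi j) (G.nonneg i j)
      _ = |(√(G.degree i))⁻¹ * x i| * G.degree i := by
          rw [← Finset.sum_mul, degree, mul_comm]
  have h1 : |1 - t| ≤ 1 := by
    rw [mul_assoc] at hle
    exact le_of_mul_le_mul_right (by linarith) (mul_pos hyi hdi)
  rw [abs_le] at h1
  constructor <;> linarith [h1.1, h1.2]

theorem filter_isHermitian (p : ℝ[X]) : (G.filter p).IsHermitian := by
  have hsa : IsSelfAdjoint G.normLap := G.normLap_isHermitian.isSelfAdjoint
  rw [filter, ← cfc_polynomial p G.normLap hsa]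
  exact cfc_predicate p.eval G.normLap

/-- The filter of a polynomial that is positive on `[0, 2]` is positive definite. -/
theorem filter_posDef {p : ℝ[X]} (hp : ∀ t ∈ Set.Icc (0 : ℝ) 2, 0 < p.eval t) :
    (G.filter p).PosDef := by
  have hsa : IsSelfAdjoint G.normLap := G.normLap_isHermitian.isSelfAdjoint
  refine (G.filter_isHermitian p).posDef_iff_eigenvalues_pos.2 fun i => ?_
  have hmem := (G.filter_isHermitian p).eigenvalues_mem_spectrum_real i
  have hspec : spectrum ℝ (G.filter p) = p.eval '' spectrum ℝ G.normLap := by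
    rw [filter, ← cfc_polynomial p G.normLap hsa,
      cfc_map_spectrum p.eval G.normLap hsa p.continuous.continuousOn]
  rw [hspec] at hmem
  obtain ⟨t, ht, h⟩ := hmem
  rw [← h]
  exact hp t (G.spectrum_normLap_subset ht)

/-! ### The three claims about `R` -/

theorem filter_add_diagonal_posDef {p : ℝ[X]} (hp : ∀ t ∈ Set.Icc (0 : ℝ) 2, 0 < p.eval t)
    {q : V → ℝ} (hq : ∀ i, 0 < q i) : (G.filter p + Matrix.diagonal q).PosDef :=
  (G.filter_posDef hp).add (Matrix.PosDef.diagonal hq)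

theorem tikhonov_apply (p : ℝ[X]) (q : V → ℝ) (i j : V) :
    G.tikhonov p q i j = (G.filter p + Matrix.diagonal q)⁻¹ i j * q j := by
  rw [tikhonov, Matrix.mul_diagonal]

/-- A diagonal matrix that is constant on components commutes with the normalized Laplacian. -/
theorem commute_diagonal_normLap {d : V → ℝ} (hd : ∀ i j, G.graph.Adj i j → d i = d j) :
    Commute (Matrix.diagonal d) G.normLap := by
  ext i j
  rw [Matrix.diagonal_mul, Matrix.mul_diagonal]
  by_cases hij : i = j
  · rw [hij, mul_comm]
  · by_cases h : G.adj i j = 0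
    · rw [G.normLap_apply_of_ne hij, h]; ring
    · rw [hd i j h, mul_comm]

theorem commute_diagonal_filter {d : V → ℝ} (hd : ∀ i j, G.graph.Adj i j → d i = d j)
    (p : ℝ[X]) : Commute (Matrix.diagonal d) (G.filter p) := by
  rw [filter]
  induction p using Polynomial.induction_on' with
  | add p r hp hr => rw [map_add]; exact hp.add_right hr
  | monomial n a =>
    rw [aeval_monomial]
    exact (Algebra.commute_algebraMap_right a _).mul_right ((G.commute_diagonal_normLap hd).pow_right n)

theorem tikhonov_eq_zero (p : ℝ[X]) (q : V → ℝ) {i j : V}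
    (hij : G.graph.connectedComponentMk i ≠ G.graph.connectedComponentMk j) :
    G.tikhonov p q i j = 0 := by
  classical
  let d : V → ℝ := fun k =>
    if G.graph.connectedComponentMk k = G.graph.connectedComponentMk i then 1 else 0
  have hd : ∀ k l, G.graph.Adj k l → d k = d l := fun k l h => by
    simp only [d, SimpleGraph.ConnectedComponent.eq.2 h.reachable]
  have hcomm : Commute (Matrix.diagonal d) (G.filter p + Matrix.diagonal q) :=
    (G.commute_diagonal_filter hd p).add_right (Matrix.commute_diagonal d q)
  rw [tikhonov_apply, Matrix.inv_apply_eq_zero_of_commute hcomm, zero_mul]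
  have hji : d j = 0 := if_neg hij.symm
  have hii : d i = 1 := if_pos rfl
  rw [hii, hji]
  exact one_ne_zero

/-- The constant `a` and the matrix `Q` only affect the diagonal; off it, `M` equals `b * L`, which
is nonpositive and nonzero on edges. -/
theorem tikhonov_pos_of_linear {a b : ℝ} (hb : 0 < b)
    (hp : ∀ t ∈ Set.Icc (0 : ℝ) 2, 0 < (C a + C b * X).eval t) {q : V → ℝ} (hq : ∀ i, 0 < q i)
    {i j : V} (hij : G.graph.Reachable i j) : 0 < G.tikhonov (C a + C b * X) q i j := by
  have hoff : ∀ k l, k ≠ l → (G.filter (C a + C b * X) + Matrix.diagonal q) k l =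
      b * G.normLap k l := fun k l hkl => by
    simp [filter, hkl, Matrix.algebraMap_matrix_apply, ← Algebra.smul_def]
  rw [tikhonov_apply]
  refine mul_pos ((G.filter_add_diagonal_posDef hp hq).inv_pos_of_offDiag_nonpos
    (H := G.graph) (fun k l hkl => ?_) (fun k l hkl => ?_) hij) (hq j)
  · rw [hoff k l hkl]
    exact mul_nonpos_of_nonneg_of_nonpos hb.le (G.normLap_nonpos_of_ne hkl)
  · rw [hoff k l hkl.ne]
    exact mul_ne_zero hb.ne' (G.normLap_ne_zero_of_adj hkl)

theorem ae_tikhonov_ne_zero {p : ℝ[X]} (hp : ∀ t ∈ Set.Icc (0 : ℝ) 2, 0 < p.eval t) {K : ℕ}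
    (hK : 0 < K) (hsupp : G.CompleteHopSupport (G.filter p) K) :
    ∀ᵐ q : V → ℝ, (∀ i, 0 < q i) → ∀ i j, G.graph.Reachable i j → G.tikhonov p q i j ≠ 0 := by
  let H : SimpleGraph V :=
    { Adj := fun u v => u ≠ v ∧ G.filter p u v ≠ 0
      symm := ⟨fun u v h => ⟨h.1.symm, by rw [← (G.filter_isHermitian p).apply]; simpa using h.2⟩⟩
      loopless := ⟨fun u h => h.1 rfl⟩ }
  -- Since `K ≥ 1`, adjacent vertices lie within `K` hops, so vertices connected in `G` are
  -- connected through nonzero entries of `p(L)`.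
  have hle : G.graph ≤ H := fun u v h => by
    refine ⟨h.ne, (hsupp u v).2 ?_⟩
    rw [SimpleGraph.edist_eq_one_iff_adj.2 h]
    exact_mod_cast hK
  have hae : ∀ᵐ q : V → ℝ, ∀ i j, G.graph.Reachable i j →
      (G.filter p + Matrix.diagonal q).adjugate i j ≠ 0 := by
    simp only [ae_all_iff]
    intro i j hij
    exact Matrix.ae_adjugate_add_diagonal_ne_zero (H := H) (fun _ _ => Iff.rfl) (hij.mono hle)
  filter_upwards [hae] with q hadj hq i j hij
  rw [tikhonov_apply, Matrix.inv_def, Matrix.smul_apply, smul_eq_mul, Ring.inverse_eq_inv']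
  exact mul_ne_zero (mul_ne_zero (inv_ne_zero (G.filter_add_diagonal_posDef hp hq).det_pos.ne')
    (hadj i j hij)) (hq j).ne'

end WeightedGraph

theorem proposition4 {V : Type*} [Fintype V] [DecidableEq V] (G : WeightedGraph V)
    (p : ℝ[X]) (K : ℕ) (hK : 0 < K) (hdeg : p.natDegree = K)
    (hp : ∀ t ∈ Set.Icc (0 : ℝ) 2, 0 < p.eval t ∧ p.eval t < 1) :
    -- the inverse in the definition of `R` exists
    (∀ q : V → ℝ, (∀ i, 0 < q i) → IsUnit (G.filter p + Matrix.diagonal q)) ∧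
    -- (i)
    (∀ q : V → ℝ, (∀ i, 0 < q i) → ∀ i j,
      G.graph.connectedComponentMk i ≠ G.graph.connectedComponentMk j →
        G.tikhonov p q i j = 0) ∧
    -- (ii)
    (∀ a b : ℝ, 0 < b → p = C a + C b * X → ∀ q : V → ℝ, (∀ i, 0 < q i) → ∀ i j,
      G.graph.connectedComponentMk i = G.graph.connectedComponentMk j →
        0 < G.tikhonov p q i j) ∧
    -- (iii)
    (G.CompleteHopSupport (G.filter p) K →
      ∀ᵐ q : V → ℝ ∂volume, (∀ i, 0 < q i) → ∀ i j,
        G.graph.connectedComponentMk i = G.graph.connectedComponentMk j →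
          G.tikhonov p q i j ≠ 0) := by
  have hpos : ∀ t ∈ Set.Icc (0 : ℝ) 2, 0 < p.eval t := fun t ht => (hp t ht).1
  refine ⟨fun q hq => (G.filter_add_diagonal_posDef hpos hq).isUnit,
    fun q _ i j hij => G.tikhonov_eq_zero p q hij, ?_, fun hsupp => ?_⟩
  · rintro a b hb rfl q hq i j hij
    exact G.tikhonov_pos_of_linear hb hpos hq (SimpleGraph.ConnectedComponent.eq.1 hij)
  · filter_upwards [G.ae_tikhonov_ne_zero hpos hK hsupp] with q h hq i j hij
    exact h hq i j (SimpleGraph.ConnectedComponent.eq.1 hij)
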